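/- Let $n\ge 0$, let $\mathcal O_n=\mathbb C\{x_1,\dots,x_n\}$ be the ring of convergent power series (germs of holomorphic functions at $0\in\mathbb C^n$), and let $\mathfrak m$ be its maximal ideal. For $f\in\mathcal O_n$ let $j(f)=\langle \partial f/\partial x_1,\dots,\partial f/\partial x_n\rangle$ and $T_{\mathcal K}(f)=\langle f\rangle+\mathfrak m\, j(f)$. For an ideal $J=\langle g_1,\dots,g_q\rangle$ of $\mathcal O_n$ let $T_{\mathcal K}(J)=T_{\mathcal K}(g_1)+\dots+T_{\mathcal K}(g_q)=\sum_{g\in J}T_{\mathcal K}(g)$, which does not depend on the generators. For an ideal $I$ let $\Delta_1(I)=\{f\in\mathcal O_n : T_{\mathcal K}(f)\subseteq I\}$, which is an ideal. An ideal $I$ is a *moduli ideal* if $I=T_{\mathcal K}(f)$ for some $f\in\mathfrak m$, and it is *$T_{\mathcal K}$-full* if $T_{\mathcal K}(\Delta_1(I))=I$. An ideal $J=\langle g_1,\dots,g_q\rangle$ with $q\ge 1$ is *$T_{\mathcal K}$-dependent* if the following holds (the condition does not depend on the choice of generators). Let $S=\mathcal O_n[\alpha_1,\dots,\alpha_q]$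 with the standard grading, $\pi:\mathbb P^{q-1}=\operatorname{Proj} S\to\operatorname{Spec}\mathcal O_n$ the structure morphism, $\sigma=\sum_i g_i\alpha_i$ and $\frac{\partial\sigma}{\partial x_j}=\sum_i\frac{\partial g_i}{\partial x_j}\alpha_i$. Let $\mathscr T_{\mathcal K}(\sigma)$ be the ideal sheaf on $\mathbb P^{q-1}$ associated to the homogeneous ideal $\langle \sigma,\ \mathfrak m\frac{\partial\sigma}{\partial x_1},\dots,\mathfrak m\frac{\partial\sigma}{\partial x_n}\rangle$ of $S$; it is a subsheaf of $\pi^*(T_{\mathcal K}(J))$, the ideal sheaf associated to $T_{\mathcal K}(J)S$. The condition is that the special fibre $\pi^{-1}(\mathfrak m)$ is not contained in the support of the sheaf $\pi^*(T_{\mathcal K}(J))/\mathscr T_{\mathcal K}(\sigma)$. **Theorem.** Let $I\subsetneq\mathcal O_n$ be a proper ideal. Then $I$ is a moduli ideal if and only if $I$ is $T_{\mathcal K}$-full and $\Delta_1(I)$ is $T_{\mathcal K}$-dependent. -/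

import Mathlib

/-! ### The ring of convergent power series -/

/-- A power series in `n` variables with complex coefficients is convergent if it converges
absolutely on some polydisc `{|x₁| ≤ r, …, |xₙ| ≤ r}` with `r > 0`. -/
def IsConvergent {n : ℕ} (f : MvPowerSeries (Fin n) ℂ) : Prop :=
  ∃ r : ℝ, 0 < r ∧ Summable fun k : Fin n →₀ ℕ => ‖MvPowerSeries.coeff k f‖ * r ^ k.degree

theorem summable_of_le_radius {n : ℕ} {f : MvPowerSeries (Fin n) ℂ} {r s : ℝ} (hs : 0 < s)
    (hsr : s ≤ r)
    (h : Summable fun k : Fin n →₀ ℕ => ‖MvPowerSeries.coeff k f‖ * r ^ k.degree) :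
    Summable fun k : Fin n →₀ ℕ => ‖MvPowerSeries.coeff k f‖ * s ^ k.degree :=
  Summable.of_nonneg_of_le (fun k => by positivity) (fun k => by gcongr) h

theorem isConvergent_C {n : ℕ} (c : ℂ) :
    IsConvergent (MvPowerSeries.C c : MvPowerSeries (Fin n) ℂ) := by
  classical
  refine ⟨1, one_pos, summable_of_ne_finset_zero (s := {0}) fun k hk => ?_⟩
  have hk' : k ≠ 0 := by simpa using hk
  simp [MvPowerSeries.coeff_C, hk']

theorem IsConvergent.add {n : ℕ} {f g : MvPowerSeries (Fin n) ℂ} (hf : IsConvergent f)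
    (hg : IsConvergent g) : IsConvergent (f + g) := by
  obtain ⟨r, hr, hf⟩ := hf
  obtain ⟨s, hs, hg⟩ := hg
  have ht : 0 < min r s := lt_min hr hs
  refine ⟨min r s, ht, Summable.of_nonneg_of_le (fun k => by positivity) (fun k => ?_)
    ((summable_of_le_radius ht (min_le_left r s) hf).add
      (summable_of_le_radius ht (min_le_right r s) hg))⟩
  rw [← add_mul, map_add]
  gcongr
  exact norm_add_le _ _

theorem IsConvergent.mul {n : ℕ} {f g : MvPowerSeries (Fin n) ℂ} (hf : IsConvergent f)
    (hg : IsConvergent g) : IsConvergent (f * g) := by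
  obtain ⟨r, hr, hf⟩ := hf
  obtain ⟨s, hs, hg⟩ := hg
  have ht : 0 < min r s := lt_min hr hs
  have h1 := summable_of_le_radius ht (min_le_left r s) hf
  have h2 := summable_of_le_radius ht (min_le_right r s) hg
  generalize min r s = t at ht h1 h2
  have h3 : Summable fun k : Fin n →₀ ℕ => ∑ p ∈ Finset.HasAntidiagonal.antidiagonal k,
      (‖MvPowerSeries.coeff p.1 f‖ * t ^ p.1.degree) *
        (‖MvPowerSeries.coeff p.2 g‖ * t ^ p.2.degree) :=
    summable_sum_mul_antidiagonal_of_summable_mul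
      (f := fun k : Fin n →₀ ℕ => ‖MvPowerSeries.coeff k f‖ * t ^ k.degree)
      (g := fun k : Fin n →₀ ℕ => ‖MvPowerSeries.coeff k g‖ * t ^ k.degree)
      (h1.mul_of_nonneg h2 (fun k => by positivity) (fun k => by positivity))
  have h4 : ∀ k : Fin n →₀ ℕ, ‖MvPowerSeries.coeff k (f * g)‖ * t ^ k.degree ≤
      ∑ p ∈ Finset.HasAntidiagonal.antidiagonal k, (‖MvPowerSeries.coeff p.1 f‖ * t ^ p.1.degree) *
        (‖MvPowerSeries.coeff p.2 g‖ * t ^ p.2.degree) := by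
    intro k
    rw [MvPowerSeries.coeff_mul]
    refine (mul_le_mul_of_nonneg_right (norm_sum_le _ _) (by positivity)).trans ?_
    rw [Finset.sum_mul]
    refine Finset.sum_le_sum fun p hp => ?_
    rw [← Finset.HasAntidiagonal.mem_antidiagonal.mp hp, norm_mul, map_add, pow_add]
    exact le_of_eq (by ring)
  exact ⟨t, ht, Summable.of_nonneg_of_le (fun k => by positivity) h4 h3⟩

theorem IsConvergent.pderiv {n : ℕ} {f : MvPowerSeries (Fin n) ℂ} (hf : IsConvergent f)
    (i : Fin n) : IsConvergent (MvPowerSeries.pderiv ℂ i f) := by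
  obtain ⟨r, hr, hf⟩ := hf
  have hinj : Function.Injective fun k : Fin n →₀ ℕ => k + Finsupp.single i 1 :=
    add_left_injective _
  refine ⟨r / 2, by positivity, Summable.of_nonneg_of_le (fun k => by positivity) (fun k => ?_)
    ((hf.comp_injective hinj).mul_left r⁻¹)⟩
  have h1 : (k i : ℝ) + 1 ≤ 2 ^ k.degree := by
    have h2 : k i + 1 ≤ 2 ^ k.degree :=
      (Nat.lt_two_pow_self (n := k i)).trans_le
        (Nat.pow_le_pow_right (by norm_num) (Finsupp.le_degree i k))
    exact_mod_cast h2
  have h3 : ‖((k i : ℂ) + 1)‖ = (k i : ℝ) + 1 := by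
    have h4 : ((k i : ℂ) + 1) = ((k i + 1 : ℕ) : ℂ) := by push_cast; ring
    rw [h4, Complex.norm_natCast]; push_cast; ring
  simp only [Function.comp_apply, MvPowerSeries.coeff_pderiv, norm_mul, h3, map_add,
    Finsupp.degree_single, div_pow, pow_succ]
  have h5 : ((k i : ℝ) + 1) / 2 ^ k.degree ≤ 1 := (div_le_one (by positivity)).mpr h1
  have h6 : 0 ≤ ‖(MvPowerSeries.coeff (k + Finsupp.single i 1)) f‖ * r ^ k.degree := by positivity
  calc _ = ‖(MvPowerSeries.coeff (k + Finsupp.single i 1)) f‖ * r ^ k.degree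
        * (((k i : ℝ) + 1) / 2 ^ k.degree) := by ring
    _ ≤ ‖(MvPowerSeries.coeff (k + Finsupp.single i 1)) f‖ * r ^ k.degree * 1 := by gcongr
    _ = _ := by field_simp

/-- The convergent power series form a `ℂ`-subalgebra of `ℂ⟦x₁, …, xₙ⟧`. -/
def convergentSeries (n : ℕ) : Subalgebra ℂ (MvPowerSeries (Fin n) ℂ) where
  carrier := {f | IsConvergent f}
  mul_mem' := IsConvergent.mul
  add_mem' := IsConvergent.add
  algebraMap_mem' := isConvergent_C

/-- `𝒪ₙ = ℂ{x₁, …, xₙ}`, the ring of convergent power series, that is, of germs at `0` of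
holomorphic functions on `ℂⁿ`. -/
def OO (n : ℕ) : Type := ↥(convergentSeries n)

noncomputable instance (n : ℕ) : CommRing (OO n) := inferInstanceAs (CommRing ↥(convergentSeries n))

/-- The partial derivative `∂f/∂xᵢ` of a germ `f`. -/
noncomputable def partialDeriv {n : ℕ} (i : Fin n) (f : OO n) : OO n :=
  ⟨MvPowerSeries.pderiv ℂ i f.1, IsConvergent.pderiv f.2 i⟩

theorem partialDeriv_add {n : ℕ} (i : Fin n) (f g : OO n) :
    partialDeriv i (f + g) = partialDeriv i f + partialDeriv i g :=
  Subtype.ext (map_add (MvPowerSeries.pderiv ℂ i) _ _)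

theorem partialDeriv_mul {n : ℕ} (i : Fin n) (f g : OO n) :
    partialDeriv i (f * g) = f * partialDeriv i g + g * partialDeriv i f :=
  Subtype.ext ((MvPowerSeries.pderiv ℂ i).leibniz _ _)

/-- The value `f(0)` of a germ `f`, i.e. its constant coefficient. -/
noncomputable def evalZero (n : ℕ) : OO n →+* ℂ where
  toFun f := MvPowerSeries.constantCoeff f.1
  map_one' := map_one (MvPowerSeries.constantCoeff (σ := Fin n) (R := ℂ))
  map_mul' f g := map_mul MvPowerSeries.constantCoeff f.1 g.1
  map_zero' := map_zero (MvPowerSeries.constantCoeff (σ := Fin n) (R := ℂ))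
  map_add' f g := map_add MvPowerSeries.constantCoeff f.1 g.1

/-- The maximal ideal `𝔪` of `𝒪ₙ`, consisting of the germs that vanish at the origin. -/
noncomputable def maxIdeal (n : ℕ) : Ideal (OO n) := RingHom.ker (evalZero n)

instance maxIdeal_isMaximal (n : ℕ) : (maxIdeal n).IsMaximal :=
  RingHom.ker_isMaximal_of_surjective (evalZero n) fun c =>
    ⟨⟨MvPowerSeries.C c, isConvergent_C c⟩, MvPowerSeries.constantCoeff_C (σ := Fin n) c⟩

/-! ### Moduli ideals and anti-derivatives -/

/-- The Jacobian ideal `j(f) = ⟨∂f/∂x₁, …, ∂f/∂xₙ⟩`. -/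
noncomputable def jacobianIdeal {n : ℕ} (f : OO n) : Ideal (OO n) :=
  Ideal.span (Set.range fun i : Fin n => partialDeriv i f)

/-- The ideal `T_𝒦(f) = ⟨f, 𝔪 j(f)⟩`. -/
noncomputable def TK {n : ℕ} (f : OO n) : Ideal (OO n) :=
  Ideal.span {f} ⊔ maxIdeal n * jacobianIdeal f

theorem mul_partialDeriv_mem_TK {n : ℕ} {f m : OO n} (hm : m ∈ maxIdeal n) (i : Fin n) :
    m * partialDeriv i f ∈ TK f :=
  Ideal.mem_sup_right (Ideal.mul_mem_mul hm (Ideal.subset_span ⟨i, rfl⟩))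

theorem self_mem_TK {n : ℕ} (f : OO n) : f ∈ TK f :=
  Ideal.mem_sup_left (Ideal.mem_span_singleton_self f)

theorem TK_le_iff {n : ℕ} {f : OO n} {I : Ideal (OO n)} :
    TK f ≤ I ↔ f ∈ I ∧ ∀ m ∈ maxIdeal n, ∀ i, m * partialDeriv i f ∈ I := by
  constructor
  · exact fun h => ⟨h (self_mem_TK f), fun m hm i => h (mul_partialDeriv_mem_TK hm i)⟩
  · rintro ⟨h1, h2⟩
    refine sup_le (by rwa [Ideal.span_singleton_le_iff_mem]) (Ideal.mul_le.mpr fun m hm x hx => ?_)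
    induction hx using Submodule.span_induction with
    | mem x hx => obtain ⟨i, rfl⟩ := hx; exact h2 m hm i
    | zero => simp
    | add x y _ _ hx hy => rw [mul_add]; exact I.add_mem hx hy
    | smul a x _ hx => rw [smul_eq_mul, mul_left_comm]; exact I.mul_mem_left a hx

/-- `I` is a moduli ideal: `I = T_𝒦(f)` for some `f ∈ 𝔪`. -/
def IsModuliIdeal {n : ℕ} (I : Ideal (OO n)) : Prop :=
  ∃ f ∈ maxIdeal n, I = TK f

/-- The ideal of anti-derivatives `Δ₁(I) = {f | T_𝒦(f) ⊆ I}`. -/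
noncomputable def antiDeriv {n : ℕ} (I : Ideal (OO n)) : Ideal (OO n) where
  carrier := {f | TK f ≤ I}
  zero_mem' := by
    have h0 : ∀ i : Fin n, partialDeriv i (0 : OO n) = 0 := fun i =>
      Subtype.ext (map_zero (MvPowerSeries.pderiv ℂ i))
    exact TK_le_iff.mpr ⟨I.zero_mem, fun m _ i => by simp [h0]⟩
  add_mem' := by
    intro f g hf hg
    have hf' := TK_le_iff.mp hf
    have hg' := TK_le_iff.mp hg
    refine TK_le_iff.mpr ⟨I.add_mem hf'.1 hg'.1, fun m hm i => ?_⟩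
    rw [partialDeriv_add, mul_add]
    exact I.add_mem (hf'.2 m hm i) (hg'.2 m hm i)
  smul_mem' := by
    intro a f hf
    have hf' := TK_le_iff.mp hf
    refine TK_le_iff.mpr ⟨I.mul_mem_left a hf'.1, fun m hm i => ?_⟩
    rw [smul_eq_mul, partialDeriv_mul, mul_add, mul_left_comm, mul_left_comm m f, mul_comm f]
    exact I.add_mem (I.mul_mem_left a (hf'.2 m hm i)) (I.mul_mem_left _ hf'.1)

theorem mem_antiDeriv {n : ℕ} {I : Ideal (OO n)} {f : OO n} : f ∈ antiDeriv I ↔ TK f ≤ I :=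
  Iff.rfl

/-- The moduli ideal `T_𝒦(J)` of an ideal `J`, the sum of the `T_𝒦(g)` over all `g ∈ J`. It is
enough to let `g` run through generators of `J`, see `TKIdeal_span`. -/
noncomputable def TKIdeal {n : ℕ} (J : Ideal (OO n)) : Ideal (OO n) :=
  ⨆ g ∈ J, TK g

theorem TKIdeal_span {n q : ℕ} (g : Fin q → OO n) :
    TKIdeal (Ideal.span (Set.range g)) = ⨆ i, TK (g i) := by
  apply le_antisymm
  · have h : Ideal.span (Set.range g) ≤ antiDeriv (⨆ i, TK (g i)) := by
      rw [Ideal.span_le]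
      rintro _ ⟨i, rfl⟩
      exact le_iSup (fun i => TK (g i)) i
    exact iSup₂_le fun f hf => h hf
  · exact iSup_le fun i => le_iSup₂_of_le (g i) (Ideal.subset_span ⟨i, rfl⟩) le_rfl

/-- `I` is `T_𝒦`-full: `T_𝒦(Δ₁(I)) = I`. -/
def IsTKFull {n : ℕ} (I : Ideal (OO n)) : Prop :=
  TKIdeal (antiDeriv I) = I

/-! ### The projective space over `Spec 𝒪ₙ` and `T_𝒦`-dependence -/

section Dependence

open AlgebraicGeometry CategoryTheory

attribute [local instance] MvPolynomial.gradedAlgebra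

/-- The standard grading of `S = 𝒪ₙ[α₁, …, α_q]`. -/
noncomputable abbrev gradingS (n q : ℕ) : ℕ → Submodule (OO n) (MvPolynomial (Fin q) (OO n)) :=
  MvPolynomial.homogeneousSubmodule (Fin q) (OO n)

/-- The projective space `ℙ^{q-1} = Proj S` over `𝒪ₙ`. -/
noncomputable abbrev projSpace (n q : ℕ) : Scheme := Proj (gradingS n q)

/-- The structure morphism `π : ℙ^{q-1} ⟶ Spec 𝒪ₙ`. -/
noncomputable def projMap (n q : ℕ) : projSpace n q ⟶ Spec (CommRingCat.of (OO n)) :=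
  Proj.toSpecZero (gradingS n q) ≫
    Spec.map (CommRingCat.ofHom (algebraMap (OO n) (gradingS n q 0)))

/-- The closed point `𝔪` of `Spec 𝒪ₙ`. -/
noncomputable def closedPt (n : ℕ) : Spec (CommRingCat.of (OO n)) :=
  (⟨maxIdeal n, (maxIdeal_isMaximal n).isPrime⟩ : PrimeSpectrum (OO n))

/-- The special fibre `π⁻¹(𝔪)`. -/
def specialFibre (n q : ℕ) : Set (projSpace n q) :=
  {P | (projMap n q) P = closedPt n}

/-- The section `σ = ∑ gᵢ αᵢ`. -/
noncomputable def sigma {n q : ℕ} (g : Fin q → OO n) : MvPolynomial (Fin q) (OO n) :=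
  ∑ i, MvPolynomial.C (g i) * MvPolynomial.X i

/-- The homogeneous ideal `⟨σ, 𝔪 ∂σ/∂x₁, …, 𝔪 ∂σ/∂xₙ⟩` of `S`, where
`∂σ/∂xⱼ = ∑ (∂gᵢ/∂xⱼ) αᵢ`. -/
noncomputable def TKSigma {n q : ℕ} (g : Fin q → OO n) : Ideal (MvPolynomial (Fin q) (OO n)) :=
  Ideal.span {sigma g} ⊔
    (maxIdeal n).map MvPolynomial.C *
      Ideal.span (Set.range fun j : Fin n => sigma fun i => partialDeriv j (g i))

/-- The stalk `𝒪_{ℙ^{q-1}, P} = S_(P)`, the ring of elements of degree zero of the localization of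
`S` at `P`; see `AlgebraicGeometry.Proj.stalkIso`. -/
abbrev stalkRing {n q : ℕ} (P : ProjectiveSpectrum (gradingS n q)) : Type :=
  HomogeneousLocalization.AtPrime (gradingS n q) P.asHomogeneousIdeal.toIdeal

/-- For a homogeneous ideal `𝔞` of `S`, the stalk `𝔞_(P)` at `P` of the ideal sheaf on `Proj S`
associated to `𝔞`: the elements of degree zero of the localization `𝔞 S_P`. -/
noncomputable def stalkIdeal {n q : ℕ} (𝔞 : Ideal (MvPolynomial (Fin q) (OO n)))
    (P : ProjectiveSpectrum (gradingS n q)) : Ideal (stalkRing P) :=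
  (𝔞.map (algebraMap (MvPolynomial (Fin q) (OO n))
      (Localization.AtPrime P.asHomogeneousIdeal.toIdeal))).comap
    (algebraMap (stalkRing P) (Localization.AtPrime P.asHomogeneousIdeal.toIdeal))

/-- The stalk at `P` of `ℱ = π^*(T_𝒦(J)) / 𝒯_𝒦(σ)`, where `J = ⟨g₁, …, g_q⟩`. Here `π^*(T_𝒦(J))`
is the ideal sheaf associated to `T_𝒦(J) S`, and `𝒯_𝒦(σ)`, the one associated to
`⟨σ, 𝔪 ∂σ/∂x₁, …, 𝔪 ∂σ/∂xₙ⟩`, is a subsheaf of it (see `TKSigma_le`). -/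
abbrev sheafStalk {n q : ℕ} (g : Fin q → OO n) (P : ProjectiveSpectrum (gradingS n q)) : Type :=
  let B : Ideal (stalkRing P) :=
    stalkIdeal ((TKIdeal (Ideal.span (Set.range g))).map MvPolynomial.C) P
  ↥B ⧸ Submodule.comap B.subtype (stalkIdeal (TKSigma g) P)

/-- The support of `ℱ = π^*(T_𝒦(J)) / 𝒯_𝒦(σ)`: the points at which its stalk is not zero. -/
def sheafSupport {n q : ℕ} (g : Fin q → OO n) : Set (projSpace n q) :=
  {P | Nontrivial (sheafStalk g P)}

theorem TKSigma_le {n q : ℕ} (g : Fin q → OO n) :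
    TKSigma g ≤ (TKIdeal (Ideal.span (Set.range g))).map MvPolynomial.C := by
  rw [TKIdeal_span]
  refine sup_le ?_ (Ideal.mul_le.mpr fun a ha b hb => ?_)
  · rw [Ideal.span_singleton_le_iff_mem]
    exact Ideal.sum_mem _ fun i _ => Ideal.mul_mem_right _ _ (Ideal.mem_map_of_mem _
      (Ideal.mem_iSup_of_mem i (self_mem_TK (g i))))
  · induction ha using Submodule.span_induction with
    | mem a ha =>
      obtain ⟨m, hm, rfl⟩ := ha
      induction hb using Submodule.span_induction with
      | mem b hb =>
        obtain ⟨j, rfl⟩ := hb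
        simp only [sigma, Finset.mul_sum, ← mul_assoc, ← map_mul]
        exact Ideal.sum_mem _ fun i _ => Ideal.mul_mem_right _ _ (Ideal.mem_map_of_mem _
          (Ideal.mem_iSup_of_mem i (mul_partialDeriv_mem_TK hm j)))
      | zero => simp
      | add x y _ _ hx hy => rw [mul_add]; exact Ideal.add_mem _ hx hy
      | smul c x _ hx => rw [smul_eq_mul, mul_left_comm]; exact Ideal.mul_mem_left _ c hx
    | zero => simp
    | add x y _ _ hx hy => rw [add_mul]; exact Ideal.add_mem _ hx hy
    | smul c x _ hx => rw [smul_eq_mul, mul_assoc]; exact Ideal.mul_mem_left _ c hx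

/-- The ideal `J` is `T_𝒦`-dependent: for a system of generators `g₁, …, g_q` (`q ≥ 1`) of `J`, the
special fibre `π⁻¹(𝔪)` in `ℙ^{q-1}` is not contained in the support of `π^*(T_𝒦(J)) / 𝒯_𝒦(σ)`. The
notion does not depend on the system of generators. -/
def IsTKDependent {n : ℕ} (J : Ideal (OO n)) : Prop :=
  ∃ (q : ℕ) (g : Fin q → OO n), 0 < q ∧ Ideal.span (Set.range g) = J ∧
    ¬ specialFibre n q ⊆ sheafSupport g

end Dependence

/-! Dependence produces a generic combination of generators. Let `Δ₁(I) = ⟨g₁, …, g_q⟩`, let `I` be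
full, and let `P` be a point over `𝔪` where the stalks of `I·S` and `𝒯_𝒦(σ)` agree. As `I` is
finitely generated, a single `s ∉ P` satisfies `s·I ⊆ ⟨σ, 𝔪 ∂σ/∂xⱼ⟩`. Since `𝔪S ⊆ P`, the reduction
of `s` modulo `𝔪` is a nonzero complex polynomial, hence nonzero at some `c ∈ ℂ^q`. Putting `α = c`
turns `s` into a unit of `𝒪ₙ` and `σ` into `f = ∑ cᵢ gᵢ`, so `I ⊆ T_𝒦(f) ⊆ I`
(`isModuliIdeal_of_isTKDependent`).

Conversely, if `I = T_𝒦(f)`, fullness is formal because `f ∈ Δ₁(I)`. For dependence, take generators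
of `Δ₁(I)` starting with `f` and the point `(1 : 0 : … : 0)` over `𝔪`. There `α₀` is a unit and the
other `αᵢ` lie in the maximal ideal, so `T_𝒦(f)` is contained in `𝒯_𝒦(σ)` plus the maximal ideal
times itself, and Nakayama concludes (`map_TKIdeal_le_map_TKSigma`).

The analytic input is that `𝒪ₙ` is Noetherian and that germs outside `𝔪` are units. Both follow from
division with remainder (`exists_division`). Monomials are ordered by `expNat`, an order compatible
with products in which each monomial has finitely many predecessors; the matching weights
`expNat^{-s}` make leading terms dominate as `s` grows. -/

/-! ### Norms of Dirichlet type on power series -/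

section Noetherian

open scoped ENNReal
open Filter Topology

/-- The monomial `x^k` is encoded by the natural number `∏ pᵢ^kᵢ`, where `p₀ < p₁ < …` are the
primes. -/
noncomputable def expNat {n : ℕ} (k : Fin n →₀ ℕ) : ℕ := ∏ i : Fin n, Nat.nth Nat.Prime i ^ k i

theorem expNat_add {n : ℕ} (k l : Fin n →₀ ℕ) : expNat (k + l) = expNat k * expNat l := by
  simp [expNat, pow_add, Finset.prod_mul_distrib]

theorem expNat_pos {n : ℕ} (k : Fin n →₀ ℕ) : 0 < expNat k :=
  Finset.prod_pos fun i _ => pow_pos (Nat.prime_nth_prime i).pos _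

theorem expNat_injective (n : ℕ) : Function.Injective (expNat (n := n)) := by
  have key : ∀ (k : Fin n →₀ ℕ) (j : Fin n),
      (expNat k).factorization (Nat.nth Nat.Prime j) = k j := by
    intro k j
    rw [expNat, Nat.factorization_prod_apply
      fun (i : Fin n) _ => (pow_pos (Nat.prime_nth_prime i).pos _).ne', Finset.sum_eq_single j]
    · rw [(Nat.prime_nth_prime j).factorization_pow, Finsupp.single_eq_same]
    · intro i _ hij
      rw [(Nat.prime_nth_prime i).factorization_pow, Finsupp.single_eq_of_ne]
      exact fun h => hij (Fin.ext (Nat.nth_injective Nat.infinite_setOfPred_prime h.symm))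
    · simp
  intro k l h
  ext j
  rw [← key k j, ← key l j, h]

theorem two_pow_degree_le_expNat {n : ℕ} (k : Fin n →₀ ℕ) : 2 ^ k.degree ≤ expNat k := by
  rw [Finsupp.degree_eq_sum, ← Finset.prod_pow_eq_pow_sum]
  exact Finset.prod_le_prod' fun i _ => Nat.pow_le_pow_left (Nat.prime_nth_prime i).two_le _

theorem expNat_le_pow_degree {n : ℕ} (k : Fin n →₀ ℕ) :
    expNat k ≤ Nat.nth Nat.Prime n ^ k.degree := by
  rw [Finsupp.degree_eq_sum, ← Finset.prod_pow_eq_pow_sum]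
  exact Finset.prod_le_prod' fun i _ =>
    Nat.pow_le_pow_left (Nat.nth_monotone Nat.infinite_setOfPred_prime i.2.le) _

/-- The weight `(∏ pᵢ^kᵢ)^{-s}` of `x^k`. -/
noncomputable def expWeight {n : ℕ} (s : ℕ) (k : Fin n →₀ ℕ) : ℝ≥0∞ := ((expNat k : ℝ≥0∞)⁻¹) ^ s

theorem expWeight_add {n : ℕ} (s : ℕ) (k l : Fin n →₀ ℕ) :
    expWeight s (k + l) = expWeight s k * expWeight s l := by
  rw [expWeight, expWeight, expWeight, expNat_add, Nat.cast_mul, ENNReal.mul_inv, mul_pow] <;> simp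

theorem expWeight_ne_top {n : ℕ} (s : ℕ) (k : Fin n →₀ ℕ) : expWeight s k ≠ ∞ := by
  simp [expWeight, (expNat_pos k).ne']

theorem expWeight_ne_zero {n : ℕ} (s : ℕ) (k : Fin n →₀ ℕ) : expWeight s k ≠ 0 := by
  simp [expWeight]

theorem expWeight_antitone {n : ℕ} (k : Fin n →₀ ℕ) : Antitone fun s => expWeight s k := by
  intro s t h
  refine pow_le_pow_right_of_le_one' ?_ h
  rw [ENNReal.inv_le_one]
  exact_mod_cast expNat_pos k

/-- The weighted `ℓ¹`-norm `∑ |f_k| (∏ pᵢ^kᵢ)^{-s}` of a power series. -/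
noncomputable def dirichletNorm {n : ℕ} (s : ℕ) (f : MvPowerSeries (Fin n) ℂ) : ℝ≥0∞ :=
  ∑' k, ‖MvPowerSeries.coeff k f‖ₑ * expWeight s k

theorem dirichletNorm_antitone {n : ℕ} (f : MvPowerSeries (Fin n) ℂ) :
    Antitone fun s => dirichletNorm s f := fun _ _ h =>
  ENNReal.tsum_le_tsum fun k => mul_le_mul_right (expWeight_antitone k h) _

theorem dirichletNorm_add_le {n : ℕ} (s : ℕ) (f g : MvPowerSeries (Fin n) ℂ) :
    dirichletNorm s (f + g) ≤ dirichletNorm s f + dirichletNorm s g := by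
  rw [dirichletNorm, dirichletNorm, dirichletNorm, ← ENNReal.tsum_add]
  refine ENNReal.tsum_le_tsum fun k => ?_
  rw [← add_mul, map_add]
  gcongr
  exact enorm_add_le _ _

theorem dirichletNorm_sum_le {n : ℕ} (s : ℕ) {ι : Type*} (t : Finset ι)
    (f : ι → MvPowerSeries (Fin n) ℂ) :
    dirichletNorm s (∑ i ∈ t, f i) ≤ ∑ i ∈ t, dirichletNorm s (f i) := by
  classical
  induction t using Finset.induction_on with
  | empty => simp [dirichletNorm]
  | insert a t ha ih =>
    rw [Finset.sum_insert ha, Finset.sum_insert ha]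
    exact (dirichletNorm_add_le _ _ _).trans (by gcongr)

theorem dirichletNorm_mul_le {n : ℕ} (s : ℕ) (f g : MvPowerSeries (Fin n) ℂ) :
    dirichletNorm s (f * g) ≤ dirichletNorm s f * dirichletNorm s g := by
  have h : dirichletNorm s f * dirichletNorm s g = ∑' x : (Fin n →₀ ℕ) × (Fin n →₀ ℕ),
      (‖MvPowerSeries.coeff x.1 f‖ₑ * expWeight s x.1) *
        (‖MvPowerSeries.coeff x.2 g‖ₑ * expWeight s x.2) := by
    rw [ENNReal.tsum_prod', dirichletNorm, dirichletNorm, ← ENNReal.tsum_mul_right]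
    simp_rw [ENNReal.tsum_mul_left]
  rw [h, ← Finset.HasAntidiagonal.sigmaAntidiagonalEquivProd.tsum_eq, ENNReal.tsum_sigma']
  refine ENNReal.tsum_le_tsum fun k => ?_
  rw [tsum_fintype, MvPowerSeries.coeff_mul, ← Finset.sum_coe_sort]
  refine (mul_le_mul_left (enorm_sum_le _ _) _).trans ?_
  rw [Finset.sum_mul]
  refine Finset.sum_le_sum fun p _ => le_of_eq ?_
  have hp := Finset.HasAntidiagonal.mem_antidiagonal.mp p.2
  simp only [Finset.HasAntidiagonal.sigmaAntidiagonalEquivProd_apply]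
  have hw : expWeight s k = expWeight s p.1.1 * expWeight s p.1.2 := by rw [← expWeight_add, hp]
  rw [enorm_mul, hw]
  ring

/-- The bounds `2^|k| ≤ expNat k ≤ pₙ^|k|` squeeze the weights between geometric ones, so these
norms detect convergence as polydiscs do. -/
theorem isConvergent_iff {n : ℕ} {f : MvPowerSeries (Fin n) ℂ} :
    IsConvergent f ↔ ∃ s, dirichletNorm s f ≠ ∞ := by
  have conv : ∀ r : ℝ, 0 ≤ r → ∀ k : Fin n →₀ ℕ,
      ENNReal.ofReal (‖MvPowerSeries.coeff k f‖ * r ^ k.degree) =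
        ‖MvPowerSeries.coeff k f‖ₑ * (ENNReal.ofReal r) ^ k.degree := by
    intro r hr k
    rw [ENNReal.ofReal_mul (norm_nonneg _), ofReal_norm, ENNReal.ofReal_pow hr]
  constructor
  · rintro ⟨r, hr, hf⟩
    obtain ⟨s, hs⟩ := exists_pow_lt_of_lt_one hr (by norm_num : (2⁻¹ : ℝ) < 1)
    refine ⟨s, ne_top_of_le_ne_top hf.tsum_ofReal_ne_top (ENNReal.tsum_le_tsum fun k => ?_)⟩
    rw [conv r hr.le]
    gcongr
    have h1 : expWeight s k ≤ ((2⁻¹ : ℝ≥0∞) ^ s) ^ k.degree := by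
      rw [← pow_mul, mul_comm, pow_mul, expWeight]
      refine pow_le_pow_left' ?_ s
      rw [← ENNReal.inv_pow, ENNReal.inv_le_inv]
      exact_mod_cast two_pow_degree_le_expNat k
    refine h1.trans ?_
    gcongr
    rw [← ENNReal.ofReal_ofNat, ← ENNReal.ofReal_inv_of_pos two_pos,
      ← ENNReal.ofReal_pow (by positivity)]
    exact ENNReal.ofReal_le_ofReal hs.le
  · rintro ⟨s, hs⟩
    have hp : (0 : ℝ) < Nat.nth Nat.Prime n := by exact_mod_cast (Nat.prime_nth_prime n).pos
    refine ⟨((Nat.nth Nat.Prime n : ℝ)⁻¹) ^ s, by positivity, ?_⟩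
    have h2 := ENNReal.summable_toReal (ne_top_of_le_ne_top hs
      (ENNReal.tsum_le_tsum (f := fun k : Fin n →₀ ℕ => ENNReal.ofReal
        (‖MvPowerSeries.coeff k f‖ * (((Nat.nth Nat.Prime n : ℝ)⁻¹) ^ s) ^ k.degree))
        fun k => ?_))
    · refine h2.congr fun k => ?_
      rw [ENNReal.toReal_ofReal (by positivity)]
    · rw [conv _ (by positivity)]
      gcongr
      rw [ENNReal.ofReal_pow (by positivity), ENNReal.ofReal_inv_of_pos hp, ENNReal.ofReal_natCast,
        ← pow_mul, mul_comm, pow_mul, expWeight, ← ENNReal.inv_pow]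
      gcongr
      exact_mod_cast expNat_le_pow_degree k

/-- With `m = expNat e`, every exponent of `f` has `expNat` at least `m + 1`. Raising `s` by `t`
thus gains `(m + 1)^{-t}`, while the weight of `e` loses only `m^{-t}`. -/
theorem eventually_dirichletNorm_le {n : ℕ} {f : MvPowerSeries (Fin n) ℂ} (hf : IsConvergent f)
    (e : Fin n →₀ ℕ) (h : ∀ k, expNat k ≤ expNat e → MvPowerSeries.coeff k f = 0) {ε : ℝ≥0∞}
    (hε : 0 < ε) : ∀ᶠ s in atTop, dirichletNorm s f ≤ ε * expWeight s e := by
  obtain ⟨s₀, hs⟩ := isConvergent_iff.mp hf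
  set m : ℝ≥0∞ := (expNat e : ℝ≥0∞) with hm
  have hm0 : m ≠ 0 := by simp [hm, (expNat_pos e).ne']
  have hmt : m ≠ ∞ := by simp [hm]
  have h1 : ∀ t, dirichletNorm (s₀ + t) f ≤ dirichletNorm s₀ f * ((m + 1)⁻¹) ^ t := by
    intro t
    rw [dirichletNorm, dirichletNorm, ← ENNReal.tsum_mul_right]
    refine ENNReal.tsum_le_tsum fun k => ?_
    by_cases hk : expNat k ≤ expNat e
    · simp [h k hk]
    · rw [expWeight, pow_add, ← mul_assoc, expWeight]
      gcongr
      rw [hm]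
      exact_mod_cast not_le.mp hk
  have hlt : m * (m + 1)⁻¹ < 1 := by
    rw [← div_eq_mul_inv, ENNReal.div_lt_iff (by simp) (by simp [hmt]), one_mul]
    exact ENNReal.lt_add_right hmt one_ne_zero
  have h2 : Tendsto (fun t : ℕ => dirichletNorm s₀ f * m ^ s₀ * (m * (m + 1)⁻¹) ^ t) atTop
      (𝓝 0) := by
    have := ENNReal.Tendsto.const_mul (ENNReal.tendsto_pow_atTop_nhds_zero_of_lt_one hlt)
      (a := dirichletNorm s₀ f * m ^ s₀)
      (Or.inr (ENNReal.mul_ne_top hs (ENNReal.pow_ne_top hmt)))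
    simpa using this
  have h3 : ∀ᶠ t in atTop, dirichletNorm (s₀ + t) f ≤ ε * expWeight (s₀ + t) e := by
    filter_upwards [h2.eventually_le_const hε] with t ht
    refine (h1 t).trans ?_
    calc dirichletNorm s₀ f * ((m + 1)⁻¹) ^ t
        = (dirichletNorm s₀ f * m ^ s₀ * (m * (m + 1)⁻¹) ^ t) * (m⁻¹) ^ (s₀ + t) := by
          have e1 : m ^ s₀ * m⁻¹ ^ s₀ = 1 := by
            rw [← mul_pow, ENNReal.mul_inv_cancel hm0 hmt, one_pow]
          have e2 : m ^ t * m⁻¹ ^ t = 1 := by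
            rw [← mul_pow, ENNReal.mul_inv_cancel hm0 hmt, one_pow]
          calc _ = dirichletNorm s₀ f * ((m + 1)⁻¹) ^ t * (m ^ s₀ * m⁻¹ ^ s₀)
                * (m ^ t * m⁻¹ ^ t) := by rw [e1, e2, mul_one, mul_one]
            _ = _ := by rw [mul_pow, pow_add]; ring
      _ ≤ ε * expWeight (s₀ + t) e := by rw [expWeight]; gcongr
  filter_upwards [(tendsto_sub_atTop_nat s₀).eventually h3, eventually_ge_atTop s₀] with s h4 h5
  rwa [Nat.add_sub_cancel' h5] at h4

/-! ### Division with remainder -/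

/-- Each coefficient of `Φ h` depends only on earlier coefficients of `h`, so `h + Φ h = f` is
solved by recursion along `expNat`. -/
theorem exists_eq_sub_of_triangular {n : ℕ}
    (Φ : MvPowerSeries (Fin n) ℂ → MvPowerSeries (Fin n) ℂ)
    (hΦ : ∀ j h h', (∀ k, expNat k < expNat j → MvPowerSeries.coeff k h = MvPowerSeries.coeff k h') →
      MvPowerSeries.coeff j (Φ h) = MvPowerSeries.coeff j (Φ h')) (f : MvPowerSeries (Fin n) ℂ) :
    ∃ h, h = f - Φ h := by
  have wf : WellFounded fun k l : Fin n →₀ ℕ => expNat k < expNat l :=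
    InvImage.wf expNat wellFounded_lt
  -- The default `0` for coefficients not yet constructed is harmless: by `hΦ` they do not affect
  -- coefficient `j`.
  let F : ∀ j : Fin n →₀ ℕ, (∀ k, expNat k < expNat j → ℂ) → ℂ := fun j rec =>
    MvPowerSeries.coeff j f - MvPowerSeries.coeff j
      (Φ fun k => if hk : expNat k < expNat j then rec k hk else 0)
  refine ⟨fun j => wf.fix F j, ?_⟩
  ext j
  rw [map_sub]
  change wf.fix F j = _
  rw [wf.fix_eq]
  change _ - _ = _
  congr 1
  apply hΦ
  intro k hk
  change (if hk : expNat k < expNat j then wf.fix F k else 0) = wf.fix F k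
  rw [dif_pos hk]

/-- The estimate `‖h‖ ≤ ‖f‖ + ½‖h‖` is useless while `‖h‖` may be infinite. It is applied instead to
truncations of `h`, whose norms are finite, and yields the uniform bound `2‖f‖`. -/
theorem dirichletNorm_fixedPoint_ne_top {n : ℕ} {s : ℕ}
    (Φ : MvPowerSeries (Fin n) ℂ → MvPowerSeries (Fin n) ℂ)
    (hΦ : ∀ j h h', (∀ k, expNat k < expNat j → MvPowerSeries.coeff k h = MvPowerSeries.coeff k h') →
      MvPowerSeries.coeff j (Φ h) = MvPowerSeries.coeff j (Φ h'))
    (hb : ∀ h, dirichletNorm s (Φ h) ≤ 2⁻¹ * dirichletNorm s h)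
    {f h : MvPowerSeries (Fin n) ℂ} (hf : dirichletNorm s f ≠ ∞) (hh : h = f - Φ h) :
    dirichletNorm s h ≠ ∞ := by
  let T : ℕ → MvPowerSeries (Fin n) ℂ := fun M k =>
    if expNat k ≤ M then MvPowerSeries.coeff k h else 0
  have hT : ∀ M k, MvPowerSeries.coeff k (T M) =
      if expNat k ≤ M then MvPowerSeries.coeff k h else 0 := fun _ _ => rfl
  have hfin : ∀ M, dirichletNorm s (T M) ≠ ∞ := by
    intro M
    have hs : {k : Fin n →₀ ℕ | expNat k ≤ M}.Finite :=
      (Set.finite_Iic M).preimage (expNat_injective n).injOn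
    rw [dirichletNorm, tsum_eq_sum (s := hs.toFinset)]
    · exact ENNReal.sum_ne_top.mpr fun k _ => ENNReal.mul_ne_top enorm_ne_top (expWeight_ne_top s k)
    · intro k hk
      rw [hT, if_neg (by simpa using hk)]
      simp
  have hle : ∀ M, dirichletNorm s (T M) ≤ 2 * dirichletNorm s f := by
    intro M
    have h1 : dirichletNorm s (T M) ≤ dirichletNorm s f + dirichletNorm s (Φ (T M)) := by
      rw [dirichletNorm, dirichletNorm, dirichletNorm, ← ENNReal.tsum_add]
      refine ENNReal.tsum_le_tsum fun k => ?_
      rw [← add_mul]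
      gcongr
      rw [hT]
      split_ifs with hk
      -- Up to level `M` the truncation has the same image coefficients as `h`, by triangularity.
      · rw [hΦ k (T M) h fun l hl => by rw [hT, if_pos (hl.le.trans hk)]]
        conv_lhs => rw [hh, map_sub]
        exact enorm_sub_le
      · simp
    have h2 := h1.trans (add_le_add_right (hb (T M)) _)
    set a := dirichletNorm s (T M)
    have h3 : 2⁻¹ * a ≠ ∞ := ENNReal.mul_ne_top (by simp) (hfin M)
    have h4 : 2⁻¹ * a + 2⁻¹ * a ≤ dirichletNorm s f + 2⁻¹ * a := by
      rwa [← add_mul, ENNReal.inv_two_add_inv_two, one_mul]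
    have h5 := (ENNReal.add_le_add_iff_right h3).mp h4
    calc a = 2 * (2⁻¹ * a) := by
          rw [← mul_assoc, ENNReal.mul_inv_cancel two_ne_zero ENNReal.ofNat_ne_top, one_mul]
      _ ≤ _ := by gcongr
  refine ne_top_of_le_ne_top (ENNReal.mul_ne_top ENNReal.ofNat_ne_top hf)
    (b := 2 * dirichletNorm s f) ?_
  rw [dirichletNorm, ENNReal.tsum_eq_iSup_sum]
  refine iSup_le fun t => ?_
  refine le_trans ?_ (hle (t.sup expNat))
  refine le_trans (Finset.sum_le_sum fun k hk => ?_) (ENNReal.sum_le_tsum t)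
  rw [hT, if_pos (Finset.le_sup hk)]

/-- `k` is the leading exponent of `f`, and the leading coefficient is `1`. -/
def IsMonicAt {n : ℕ} (f : MvPowerSeries (Fin n) ℂ) (e : Fin n →₀ ℕ) : Prop :=
  MvPowerSeries.coeff e f = 1 ∧ ∀ k, expNat k < expNat e → MvPowerSeries.coeff k f = 0

/-- Division with remainder by finitely many convergent power series. -/
theorem exists_division {n : ℕ} {ι : Type*} [Fintype ι] (g : ι → MvPowerSeries (Fin n) ℂ)
    (hg : ∀ i, IsConvergent (g i)) (e : ι → Fin n →₀ ℕ) (he : ∀ i, IsMonicAt (g i) (e i))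
    {f : MvPowerSeries (Fin n) ℂ} (hf : IsConvergent f) :
    ∃ (a : ι → MvPowerSeries (Fin n) ℂ) (r : MvPowerSeries (Fin n) ℂ),
      (∀ i, IsConvergent (a i)) ∧ f = r + ∑ i, a i * g i ∧
        ∀ i k, e i ≤ k → MvPowerSeries.coeff k r = 0 := by
  classical
  -- Each exponent is assigned to one `e i` below it, or to the remainder if there is none.
  have hc : ∀ k : Fin n →₀ ℕ, ∃ o : Option ι,
      (∀ i, o = some i → e i ≤ k) ∧ (o = none → ∀ i, ¬ e i ≤ k) := by
    intro k
    by_cases h : ∃ i, e i ≤ k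
    · obtain ⟨i, hi⟩ := h
      exact ⟨some i, by rintro j h; rwa [← Option.some_inj.mp h], by simp⟩
    · exact ⟨none, by simp, fun _ i hi => h ⟨i, hi⟩⟩
  choose c hc1 hc2 using hc
  let A : ι → MvPowerSeries (Fin n) ℂ → MvPowerSeries (Fin n) ℂ := fun i h p =>
    if c (p + e i) = some i then MvPowerSeries.coeff (p + e i) h else 0
  have hA : ∀ i h p, MvPowerSeries.coeff p (A i h) =
    if c (p + e i) = some i then MvPowerSeries.coeff (p + e i) h else 0 := fun _ _ _ => rfl
  let R : MvPowerSeries (Fin n) ℂ → MvPowerSeries (Fin n) ℂ := fun h k =>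
    if c k = none then MvPowerSeries.coeff k h else 0
  have hR : ∀ h k, MvPowerSeries.coeff k (R h) =
    if c k = none then MvPowerSeries.coeff k h else 0 := fun _ _ => rfl
  let τ : ι → MvPowerSeries (Fin n) ℂ := fun i => g i - MvPowerSeries.monomial (e i) 1
  have hτ0 : ∀ i k, expNat k ≤ expNat (e i) → MvPowerSeries.coeff k (τ i) = 0 := by
    intro i k hk
    simp only [τ, map_sub, MvPowerSeries.coeff_monomial]
    split_ifs with h
    · rw [h, (he i).1, sub_self]
    · rw [(he i).2 k (lt_of_le_of_ne hk fun h' => h (expNat_injective n h')), sub_zero]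
  have hτc : ∀ i, IsConvergent (τ i) := fun i => by
    have h1 : IsConvergent (MvPowerSeries.monomial (e i) (1 : ℂ)) := by
      refine ⟨1, one_pos, summable_of_ne_finset_zero (s := {e i}) fun k hk => ?_⟩
      have hk' : k ≠ e i := by simpa using hk
      simp [MvPowerSeries.coeff_monomial, hk']
    have h2 : τ i = g i + MvPowerSeries.C (-1) * MvPowerSeries.monomial (e i) 1 := by
      simp [τ, sub_eq_add_neg]
    rw [h2]
    exact (hg i).add ((isConvergent_C _).mul h1)
  have hdec : ∀ h, h = R h + ∑ i, A i h * MvPowerSeries.monomial (e i) 1 := by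
    intro h
    ext k
    simp only [map_add, map_sum, MvPowerSeries.coeff_mul_monomial, mul_one, hA, hR]
    have h1 : ∀ i, (if e i ≤ k then (if c (k - e i + e i) = some i then
        MvPowerSeries.coeff (k - e i + e i) h else 0) else 0) =
        if c k = some i then MvPowerSeries.coeff k h else 0 := by
      intro i
      split_ifs with h1 h2 h3 h3 h3
      · rw [tsub_add_cancel_of_le h1]
      · rw [tsub_add_cancel_of_le h1] at h2; exact absurd h2 h3
      · rw [tsub_add_cancel_of_le h1] at h2; exact absurd h3 h2
      · rfl
      · exact absurd (hc1 k i h3) h1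
      · rfl
    simp only [h1]
    rcases hk : c k with _ | i <;> simp
  -- Replacing the leading monomials in `hdec` by the `g i` changes `h` into `h + Φ h`; division of
  -- `f` therefore amounts to solving `h + Φ h = f`.
  let Φ : MvPowerSeries (Fin n) ℂ → MvPowerSeries (Fin n) ℂ := fun h => ∑ i, A i h * τ i
  have hΦ : ∀ j h h', (∀ k, expNat k < expNat j →
      MvPowerSeries.coeff k h = MvPowerSeries.coeff k h') →
      MvPowerSeries.coeff j (Φ h) = MvPowerSeries.coeff j (Φ h') := by
    intro j h h' hh
    simp only [Φ, map_sum, MvPowerSeries.coeff_mul]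
    refine Finset.sum_congr rfl fun i _ => Finset.sum_congr rfl fun p hp => ?_
    by_cases hq : expNat p.2 ≤ expNat (e i)
    · rw [hτ0 i _ hq, mul_zero, mul_zero]
    · rw [hA, hA, hh]
      rw [← Finset.HasAntidiagonal.mem_antidiagonal.mp hp, expNat_add, expNat_add]
      exact Nat.mul_lt_mul_of_pos_left (not_le.mp hq) (expNat_pos _)
  -- The pieces of `h` assigned to different `i` have disjoint supports.
  have hAn : ∀ s h, ∑ i, dirichletNorm s (A i h) * expWeight s (e i) ≤ dirichletNorm s h := by
    intro s h
    have h1 : ∀ i, dirichletNorm s (A i h) * expWeight s (e i) ≤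
        ∑' k, if c k = some i then ‖MvPowerSeries.coeff k h‖ₑ * expWeight s k else 0 := by
      intro i
      rw [dirichletNorm, ← ENNReal.tsum_mul_right]
      refine le_trans (le_of_eq ?_) (ENNReal.tsum_comp_le_tsum_of_injective
        (add_left_injective (e i)) _)
      refine tsum_congr fun p => ?_
      rw [mul_assoc, ← expWeight_add, hA]
      split_ifs <;> simp
    refine (Finset.sum_le_sum fun i _ => h1 i).trans ?_
    rw [← Summable.tsum_finsetSum fun _ _ => ENNReal.summable]
    refine ENNReal.tsum_le_tsum fun k => ?_
    rcases hk : c k with _ | i <;> simp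
  have hs : ∃ s, dirichletNorm s f ≠ ∞ ∧ ∀ i, dirichletNorm s (τ i) ≤ 2⁻¹ * expWeight s (e i) := by
    obtain ⟨s₀, hs₀⟩ := isConvergent_iff.mp hf
    have h1 := eventually_all.mpr fun i =>
      eventually_dirichletNorm_le (hτc i) (e i) (hτ0 i) (ε := 2⁻¹) (by simp)
    obtain ⟨s, h2, h3⟩ := (h1.and (eventually_ge_atTop s₀)).exists
    exact ⟨s, ne_top_of_le_ne_top hs₀ (dirichletNorm_antitone f h3), h2⟩
  obtain ⟨s, hsf, hsτ⟩ := hs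
  have hb : ∀ h, dirichletNorm s (Φ h) ≤ 2⁻¹ * dirichletNorm s h := by
    intro h
    calc dirichletNorm s (Φ h) ≤ ∑ i, dirichletNorm s (A i h * τ i) := dirichletNorm_sum_le _ _ _
      _ ≤ ∑ i, 2⁻¹ * (dirichletNorm s (A i h) * expWeight s (e i)) := by
        refine Finset.sum_le_sum fun i _ => (dirichletNorm_mul_le _ _ _).trans ?_
        rw [mul_left_comm]
        gcongr
        exact hsτ i
      _ ≤ _ := by rw [← Finset.mul_sum]; gcongr; exact hAn s h
  obtain ⟨h, hh⟩ := exists_eq_sub_of_triangular Φ hΦ f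
  have hhn := dirichletNorm_fixedPoint_ne_top Φ hΦ hb hsf hh
  refine ⟨fun i => A i h, R h, fun i => isConvergent_iff.mpr ⟨s, fun htop => hhn ?_⟩, ?_, ?_⟩
  · refine top_le_iff.mp (le_trans ?_ ((Finset.single_le_sum (fun _ _ => zero_le)
      (Finset.mem_univ i)).trans (hAn s h)))
    rw [htop, ENNReal.top_mul (expWeight_ne_zero s _)]
  · have h1 : f = h + Φ h := by rw [eq_sub_iff_add_eq] at hh; exact hh.symm
    rw [h1]
    nth_rw 1 [hdec h]
    simp only [Φ, τ, mul_sub, Finset.sum_sub_distrib]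
    ring
  · intro i k hik
    rw [hR, if_neg fun hk => hc2 k hk i hik]

theorem exists_isMonicAt_mul {n : ℕ} {f : OO n} (hf : f ≠ 0) :
    ∃ (c : OO n) (e : Fin n →₀ ℕ), MvPowerSeries.coeff e f.1 ≠ 0 ∧ IsMonicAt (c * f).1 e := by
  have h0 : {k : Fin n →₀ ℕ | MvPowerSeries.coeff k f.1 ≠ 0}.Nonempty := by
    by_contra h
    refine hf (Subtype.ext (MvPowerSeries.ext fun k => ?_))
    by_contra hk
    exact h ⟨k, hk⟩
  obtain ⟨e, he, hmin⟩ := (InvImage.wf (expNat (n := n)) wellFounded_lt).has_min _ h0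
  refine ⟨⟨MvPowerSeries.C (MvPowerSeries.coeff e f.1)⁻¹, isConvergent_C _⟩, e, he, ?_, fun k hk => ?_⟩
  · change MvPowerSeries.coeff e (MvPowerSeries.C _ * f.1) = 1
    rw [MvPowerSeries.coeff_C_mul, inv_mul_cancel₀ he]
  · change MvPowerSeries.coeff k (MvPowerSeries.C _ * f.1) = 0
    have h1 : MvPowerSeries.coeff k f.1 = 0 := by
      by_contra h
      exact hmin k h hk
    rw [MvPowerSeries.coeff_C_mul, h1, mul_zero]

/-- The power series underlying a germ. -/
noncomputable def OO.toSeries (n : ℕ) : OO n →+* MvPowerSeries (Fin n) ℂ :=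
  (convergentSeries n).val.toRingHom

theorem OO.exists_division {n : ℕ} {ι : Type*} [Fintype ι] (g : ι → OO n) (e : ι → Fin n →₀ ℕ)
    (he : ∀ i, IsMonicAt (g i).1 (e i)) (f : OO n) :
    ∃ (a : ι → OO n) (r : OO n), f = r + ∑ i, a i * g i ∧
      ∀ i k, e i ≤ k → MvPowerSeries.coeff k r.1 = 0 := by
  obtain ⟨a, r, ha, hf, hr⟩ := _root_.exists_division (fun i => (g i).1) (fun i => (g i).2) e he f.2
  let b : ι → OO n := fun i => ⟨a i, ha i⟩
  have hr' : (f - ∑ i, b i * g i).1 = r := by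
    change OO.toSeries n (f - ∑ i, b i * g i) = r
    rw [map_sub, map_sum]
    simp_rw [map_mul]
    exact sub_eq_of_eq_add hf
  exact ⟨b, f - ∑ i, b i * g i, (sub_add_cancel _ _).symm, fun i k hik => by rw [hr', hr i k hik]⟩

/-! ### Noetherianity and units of `𝒪ₙ`. -/

/-- The ring of convergent power series is Noetherian. -/
instance OO.isNoetherianRing (n : ℕ) : IsNoetherianRing (OO n) := by
  rw [isNoetherianRing_iff_ideal_fg]
  intro I
  let L : Set (Fin n →₀ ℕ) := {e | ∃ f ∈ I, IsMonicAt f.1 e}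
  let M : Set (Fin n →₀ ℕ) := {e | Minimal (· ∈ L) e}
  -- Dickson's lemma.
  have hM : M.Finite := WellQuasiOrderedLE.finite_of_isAntichain (setOfPred_minimal_antichain _)
  have : Fintype M := hM.fintype
  have hg : ∀ e : M, ∃ f ∈ I, IsMonicAt f.1 e.1 := fun e => e.2.1
  choose g hgI hge using hg
  have hspan : Ideal.span (Set.range g) = I := by
    apply le_antisymm
    · rw [Ideal.span_le]
      rintro _ ⟨e, rfl⟩
      exact hgI e
    · intro f hf
      obtain ⟨a, r, h1, h2⟩ := OO.exists_division g (fun e => e.1) hge f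
      have h3 : ∑ i, a i * g i ∈ Ideal.span (Set.range g) :=
        Ideal.sum_mem _ fun i _ => Ideal.mul_mem_left _ _ (Ideal.subset_span ⟨i, rfl⟩)
      have h4 : r ∈ I := by
        rw [eq_sub_of_add_eq h1.symm]
        exact I.sub_mem hf (Ideal.sum_mem _ fun i _ => Ideal.mul_mem_left _ _ (hgI i))
      by_cases hr : r = 0
      · rw [h1, hr, zero_add]
        exact h3
      -- A nonzero remainder lies in `I`, so its leading exponent dominates a minimal element of
      -- `L`, where its coefficient had to vanish.
      · obtain ⟨c, e, hce, he⟩ := exists_isMonicAt_mul hr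
        obtain ⟨e', he', hmin⟩ := exists_minimal_le_of_wellFoundedLT (· ∈ L) e
          ⟨c * r, I.mul_mem_left c h4, he⟩
        exact absurd (h2 ⟨e', hmin⟩ e he') hce
  rw [← hspan]
  exact Submodule.fg_span (Set.finite_range g)

/-- Divide `1` by `f`, normalized: the leading exponent is `0`, which lies below every exponent, so
no remainder is left. -/
theorem OO.isUnit_of_notMem {n : ℕ} {f : OO n} (hf : f ∉ maxIdeal n) : IsUnit f := by
  have h0 : MvPowerSeries.coeff 0 f.1 ≠ 0 := fun h => hf h
  let c : OO n := ⟨MvPowerSeries.C (MvPowerSeries.coeff 0 f.1)⁻¹, isConvergent_C _⟩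
  have hm : IsMonicAt (c * f).1 0 := by
    constructor
    · change MvPowerSeries.coeff 0 (MvPowerSeries.C _ * f.1) = 1
      rw [MvPowerSeries.coeff_C_mul, inv_mul_cancel₀ h0]
    · intro k hk
      have h1 : expNat (0 : Fin n →₀ ℕ) = 1 := by simp [expNat]
      have := expNat_pos k
      omega
  obtain ⟨a, r, h1, h2⟩ := OO.exists_division (fun _ : Unit => c * f) (fun _ => 0) (fun _ => hm) 1
  have hr : r = 0 := Subtype.ext (MvPowerSeries.ext fun k => h2 () k (zero_le))
  rw [hr, zero_add, Fintype.sum_unique] at h1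
  exact IsUnit.of_mul_eq_one (a () * c) (by rw [h1]; ring)

theorem OO.le_maxIdeal {n : ℕ} {I : Ideal (OO n)} (hI : I ≠ ⊤) : I ≤ maxIdeal n := fun _ hf => by
  by_contra h
  exact hI (Ideal.eq_top_of_isUnit_mem _ hf (OO.isUnit_of_notMem h))

end Noetherian

/-! ### The structure map of `Proj` on points. -/

section ProjPoints

open AlgebraicGeometry CategoryTheory

theorem mem_toSpecZero_asIdeal {A σ : Type*} [CommRing A] [SetLike σ A] [AddSubgroupClass σ A]
    (𝒜 : ℕ → σ) [GradedRing 𝒜] (x : Proj 𝒜) (a : 𝒜 0) :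
    a ∈ PrimeSpectrum.asIdeal ((Proj.toSpecZero 𝒜) x) ↔ a.1 ∈ x.asHomogeneousIdeal := by
  obtain ⟨d, f, hd, hf, hx⟩ : ∃ (d : ℕ) (f : A), 0 < d ∧ f ∈ 𝒜 d ∧ f ∉ x.asHomogeneousIdeal := by
    obtain ⟨f, hf, hfx⟩ := Set.not_subset.mp x.not_irrelevant_le
    have h1 : x ∈ Proj.basicOpen 𝒜 f := hfx
    rw [Proj.basicOpen_eq_iSup_proj, TopologicalSpace.Opens.mem_iSup] at h1
    obtain ⟨d, hd⟩ := h1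
    refine ⟨d, GradedRing.proj 𝒜 d f, Nat.pos_of_ne_zero ?_, SetLike.coe_mem _, hd⟩
    rintro rfl
    exact hd (((HomogeneousIdeal.mem_irrelevant_iff 𝒜 f).mp hf).symm ▸ zero_mem _)
  have hxr : x ∈ (Proj.awayι 𝒜 f hf hd).opensRange := by
    rw [Proj.opensRange_awayι]; exact hx
  obtain ⟨y, rfl⟩ := hxr
  -- The description of basic opens in the chart `D₊(f)` needs positive degree; `f·a` has degree
  -- `d`, and `(f·a)^d / f^d = a^d` recovers `a`.
  have hg : f * a.1 ∈ 𝒜 d := by simpa using SetLike.mul_mem_graded hf a.2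
  have h1 := congr(y ∈ $(Proj.awayι_preimage_basicOpen 𝒜 hf hd hg hd))
  have h2 : (y ∈ (Proj.awayι 𝒜 f hf hd) ⁻¹ᵁ Proj.basicOpen 𝒜 (f * a.1)) ↔
      a.1 ∉ ((Proj.awayι 𝒜 f hf hd) y).asHomogeneousIdeal := by
    change f * a.1 ∉ ((Proj.awayι 𝒜 f hf hd) y).asHomogeneousIdeal ↔ _
    rw [not_iff_not]
    refine ⟨fun h => ?_, fun h => Ideal.mul_mem_left _ _ h⟩
    exact (((Proj.awayι 𝒜 f hf hd) y).isPrime.mem_or_mem h).resolve_left hx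
  have h3 : HomogeneousLocalization.Away.isLocalizationElem hf hg =
      HomogeneousLocalization.fromZeroRingHom 𝒜 _ a ^ d := by
    apply HomogeneousLocalization.val_injective
    rw [HomogeneousLocalization.val_pow]
    change Localization.mk _ _ = (Localization.mk a.1 1) ^ d
    rw [Localization.mk_pow, one_pow, Localization.mk_eq_mk_iff, Localization.r_iff_exists]
    exact ⟨1, by simp [mul_pow]⟩
  rw [← Scheme.Hom.comp_apply, Proj.awayι_toSpecZero]
  change HomogeneousLocalization.fromZeroRingHom 𝒜 _ a ∈ PrimeSpectrum.asIdeal y ↔ _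
  rw [← not_iff_not, ← h2, h1, h3]
  change _ ↔ _ ∉ PrimeSpectrum.asIdeal y
  rw [not_iff_not]
  exact (y.isPrime.pow_mem_iff_mem d hd).symm

end ProjPoints

/-! ### Fullness and dependence give a moduli ideal. -/

section Dependence

open AlgebraicGeometry CategoryTheory

attribute [local instance] MvPolynomial.gradedAlgebra

theorem mem_specialFibre_iff {n q : ℕ} (P : ProjectiveSpectrum (gradingS n q)) :
    P ∈ specialFibre n q ↔
      ∀ a : OO n, MvPolynomial.C a ∈ P.asHomogeneousIdeal ↔ a ∈ maxIdeal n := by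
  have h1 : ∀ a : OO n, a ∈ PrimeSpectrum.asIdeal ((projMap n q) P) ↔
      MvPolynomial.C a ∈ P.asHomogeneousIdeal := fun a =>
    mem_toSpecZero_asIdeal (gradingS n q) P (algebraMap (OO n) (gradingS n q 0) a)
  change (projMap n q) P = closedPt n ↔ _
  refine (PrimeSpectrum.ext_iff.trans Ideal.ext_iff).trans ?_
  exact forall_congr' fun a => by rw [h1]; rfl

theorem notMem_sheafSupport_iff {n q : ℕ} (g : Fin q → OO n) (P : ProjectiveSpectrum (gradingS n q)) :
    P ∉ sheafSupport g ↔
      stalkIdeal ((TKIdeal (Ideal.span (Set.range g))).map MvPolynomial.C) P ≤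
        stalkIdeal (TKSigma g) P := by
  change ¬ Nontrivial (sheafStalk g P) ↔ _
  rw [not_nontrivial_iff_subsingleton, Submodule.Quotient.subsingleton_iff,
    Submodule.comap_subtype_eq_top]

/-- Constants have degree zero, so they already live in the stalk `S_(P)`; the inclusion applies to
them, and denominators are cleared in `S_P`. -/
theorem exists_mul_C_mem_of_stalkIdeal_le {n q : ℕ} {I : Ideal (OO n)}
    {T : Ideal (MvPolynomial (Fin q) (OO n))} (P : ProjectiveSpectrum (gradingS n q))
    (h : stalkIdeal (I.map MvPolynomial.C) P ≤ stalkIdeal T P) {a : OO n} (ha : a ∈ I) :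
    ∃ s ∉ P.asHomogeneousIdeal, s * MvPolynomial.C a ∈ T := by
  have h1 : HomogeneousLocalization.fromZeroRingHom (gradingS n q)
      P.asHomogeneousIdeal.toIdeal.primeCompl (algebraMap (OO n) (gradingS n q 0) a) ∈
      stalkIdeal (I.map MvPolynomial.C) P := by
    change algebraMap (MvPolynomial (Fin q) (OO n))
      (Localization.AtPrime P.asHomogeneousIdeal.toIdeal) (MvPolynomial.C a) ∈
      (I.map MvPolynomial.C).map (algebraMap (MvPolynomial (Fin q) (OO n)) _)
    exact Ideal.mem_map_of_mem _ (Ideal.mem_map_of_mem _ ha)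
  have h2 : algebraMap (MvPolynomial (Fin q) (OO n))
      (Localization.AtPrime P.asHomogeneousIdeal.toIdeal) (MvPolynomial.C a) ∈
      T.map (algebraMap _ (Localization.AtPrime P.asHomogeneousIdeal.toIdeal)) := h h1
  obtain ⟨s, hs, hT⟩ := (IsLocalization.algebraMap_mem_map_algebraMap_iff
    P.asHomogeneousIdeal.toIdeal.primeCompl _ _ _).mp h2
  exact ⟨s, hs, hT⟩

theorem Ideal.FG.exists_mul_mem {A B : Type*} [CommRing A] [CommRing B] (φ : A →+* B)
    {P T : Ideal B} (hP : P.IsPrime) {I : Ideal A} (hI : I.FG)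
    (h : ∀ a ∈ I, ∃ s ∉ P, s * φ a ∈ T) : ∃ s ∉ P, ∀ a ∈ I, s * φ a ∈ T := by
  induction I, hI using Submodule.fg_induction with
  | singleton x =>
    obtain ⟨s, hs, hx⟩ := h x (Submodule.mem_span_singleton_self x)
    refine ⟨s, hs, fun a ha => ?_⟩
    obtain ⟨b, rfl⟩ := Ideal.mem_span_singleton'.mp ha
    rw [map_mul, mul_left_comm]
    exact T.mul_mem_left _ hx
  | sup I₁ I₂ _ _ ih₁ ih₂ =>
    obtain ⟨s, hs, h1⟩ := ih₁ fun a ha => h a (Ideal.mem_sup_left ha)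
    obtain ⟨t, ht, h2⟩ := ih₂ fun a ha => h a (Ideal.mem_sup_right ha)
    refine ⟨s * t, fun hst => (hP.mem_or_mem hst).elim hs ht, fun a ha => ?_⟩
    obtain ⟨x, hx, y, hy, rfl⟩ := Submodule.mem_sup.mp ha
    have : s * t * φ (x + y) = t * (s * φ x) + s * (t * φ y) := by rw [map_add]; ring
    rw [this]
    exact T.add_mem (T.mul_mem_left _ (h1 x hx)) (T.mul_mem_left _ (h2 y hy))

/-- The constant germs. -/
noncomputable def OO.const (n : ℕ) : ℂ →+* OO n := algebraMap ℂ (convergentSeries n)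

theorem partialDeriv_const {n : ℕ} (j : Fin n) (c : ℂ) : partialDeriv j (OO.const n c) = 0 :=
  Subtype.ext ((MvPowerSeries.pderiv ℂ j).map_algebraMap c)

theorem partialDeriv_sum_mul_const {n q : ℕ} (j : Fin n) (g : Fin q → OO n) (c : Fin q → ℂ) :
    partialDeriv j (∑ i, g i * OO.const n (c i)) = ∑ i, partialDeriv j (g i) * OO.const n (c i) := by
  let D : OO n →+ OO n := AddMonoidHom.mk' (partialDeriv j) (partialDeriv_add j)
  change D _ = _
  rw [map_sum]
  refine Finset.sum_congr rfl fun i _ => ?_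
  change partialDeriv j _ = _
  rw [partialDeriv_mul, partialDeriv_const, mul_zero, zero_add, mul_comm]

/-- Specialization of the variables `αᵢ` to complex numbers `cᵢ`. -/
noncomputable def specialize {n q : ℕ} (c : Fin q → ℂ) : MvPolynomial (Fin q) (OO n) →+* OO n :=
  MvPolynomial.eval fun i => OO.const n (c i)

theorem specialize_sigma {n q : ℕ} (c : Fin q → ℂ) (g : Fin q → OO n) :
    specialize c (sigma g) = ∑ i, g i * OO.const n (c i) := by
  simp [specialize, sigma]

theorem evalZero_specialize {n q : ℕ} (c : Fin q → ℂ) (s : MvPolynomial (Fin q) (OO n)) :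
    evalZero n (specialize c s) = MvPolynomial.eval c (MvPolynomial.map (evalZero n) s) := by
  rw [specialize, MvPolynomial.eval_map, MvPolynomial.eval, MvPolynomial.coe_eval₂Hom,
    MvPolynomial.eval₂_comp_left, RingHom.comp_id]
  congr 1

/-- The `cᵢ` are constants, so specialization commutes with `∂/∂xⱼ`. -/
theorem TKSigma_le_comap_specialize {n q : ℕ} (c : Fin q → ℂ) (g : Fin q → OO n) :
    TKSigma g ≤ (TK (∑ i, g i * OO.const n (c i))).comap (specialize c) := by
  refine sup_le ?_ (Ideal.mul_le.mpr fun a ha b hb => ?_)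
  · rw [Ideal.span_singleton_le_iff_mem, Ideal.mem_comap, specialize_sigma]
    exact self_mem_TK _
  · rw [Ideal.mem_comap, map_mul]
    refine Ideal.mem_sup_right (Ideal.mul_mem_mul ?_ ?_)
    · have h : (maxIdeal n).map MvPolynomial.C ≤ (maxIdeal n).comap (specialize c) :=
        Ideal.map_le_iff_le_comap.mpr fun m hm => by
          simpa [specialize] using hm
      exact h ha
    · have h : Ideal.span (Set.range fun j : Fin n => sigma fun i => partialDeriv j (g i)) ≤
          (jacobianIdeal (∑ i, g i * OO.const n (c i))).comap (specialize c) := by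
        rw [Ideal.span_le]
        rintro _ ⟨j, rfl⟩
        change specialize c _ ∈ jacobianIdeal _
        rw [specialize_sigma, ← partialDeriv_sum_mul_const]
        exact Ideal.subset_span ⟨j, rfl⟩
      exact h hb

theorem isModuliIdeal_of_isTKDependent {n : ℕ} {I : Ideal (OO n)} (hI : I ≠ ⊤) (hfull : IsTKFull I)
    (hdep : IsTKDependent (antiDeriv I)) : IsModuliIdeal I := by
  obtain ⟨q, g, -, hg, hsup⟩ := hdep
  obtain ⟨P, hP, hPs⟩ := Set.not_subset.mp hsup
  replace hP := (mem_specialFibre_iff P).mp hP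
  replace hPs := (notMem_sheafSupport_iff g P).mp hPs
  rw [hg, hfull] at hPs
  obtain ⟨s, hs, hsI⟩ := Ideal.FG.exists_mul_mem MvPolynomial.C P.isPrime
    (IsNoetherian.noetherian I) fun a ha => exists_mul_C_mem_of_stalkIdeal_le P hPs ha
  have hs0 : MvPolynomial.map (evalZero n) s ≠ 0 := by
    intro h0
    apply hs
    have h1 : s ∈ (maxIdeal n).map (MvPolynomial.C (σ := Fin q)) := by
      rw [MvPolynomial.mem_map_C_iff]
      intro k
      have := congrArg (MvPolynomial.coeff k) h0
      rwa [MvPolynomial.coeff_map, MvPolynomial.coeff_zero] at this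
    exact Ideal.map_le_iff_le_comap.mpr (fun a ha => (hP a).mpr ha) h1
  -- A nonzero polynomial over the infinite field `ℂ` is not identically zero as a function.
  obtain ⟨c, hc⟩ : ∃ c : Fin q → ℂ, MvPolynomial.eval c (MvPolynomial.map (evalZero n) s) ≠ 0 := by
    by_contra! h
    exact hs0 (MvPolynomial.funext fun c => by rw [h c, map_zero])
  have hu : IsUnit (specialize c s) := OO.isUnit_of_notMem fun h => hc (by
    rw [← evalZero_specialize]; exact h)
  have hfJ : ∑ i, g i * OO.const n (c i) ∈ antiDeriv I := by
    rw [← hg]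
    exact Ideal.sum_mem _ fun i _ => Ideal.mul_mem_right _ _ (Ideal.subset_span ⟨i, rfl⟩)
  refine ⟨_, OO.le_maxIdeal hI (hfJ (self_mem_TK _)), le_antisymm (fun a ha => ?_) hfJ⟩
  have h1 := TKSigma_le_comap_specialize c g (hsI a ha)
  rw [Ideal.mem_comap, map_mul] at h1
  rw [← Ideal.unit_mul_mem_iff_mem _ hu]
  simpa [specialize] using h1

/-! ### Moduli ideals are full with dependent anti-derivatives. -/

theorem le_TKIdeal {n : ℕ} {J : Ideal (OO n)} {g : OO n} (hg : g ∈ J) : TK g ≤ TKIdeal J :=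
  le_iSup₂_of_le g hg le_rfl

theorem TKIdeal_antiDeriv_TK {n : ℕ} (f : OO n) : TKIdeal (antiDeriv (TK f)) = TK f :=
  le_antisymm (iSup₂_le fun _ hg => hg) (le_TKIdeal (J := antiDeriv (TK f)) (le_refl (TK f)))

/-- Reduction modulo `𝔪`, followed by `α₀ ↦ α₀` and `αᵢ ↦ 0` for `i ≠ 0`. -/
noncomputable def reduceToLine (n q : ℕ) :
    MvPolynomial (Fin (q + 1)) (OO n) →+* MvPolynomial (Fin (q + 1)) ℂ :=
  MvPolynomial.eval₂Hom (MvPolynomial.C.comp (evalZero n))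
    fun i => if i = 0 then MvPolynomial.X 0 else 0

/-- Needed for the kernel of the reduction to be a homogeneous ideal, hence a point of `Proj`. -/
theorem reduceToLine_homogeneousComponent {n q : ℕ} (d : ℕ) (a : MvPolynomial (Fin (q + 1)) (OO n)) :
    reduceToLine n q (MvPolynomial.homogeneousComponent d a) =
      MvPolynomial.homogeneousComponent d (reduceToLine n q a) := by
  have h1 : ∀ i, reduceToLine n q (MvPolynomial.homogeneousComponent i a) ∈
      MvPolynomial.homogeneousSubmodule (Fin (q + 1)) ℂ i := by
    intro i
    have := MvPolynomial.IsHomogeneous.eval₂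
      (MvPolynomial.homogeneousComponent_isHomogeneous i a) (MvPolynomial.C.comp (evalZero n))
      (fun j : Fin (q + 1) => if j = 0 then MvPolynomial.X (R := ℂ) (0 : Fin (q + 1)) else 0)
      (fun r => MvPolynomial.isHomogeneous_C _ _) (n := 1) (fun j => by
        split_ifs
        · exact MvPolynomial.isHomogeneous_X _ _
        · exact MvPolynomial.isHomogeneous_zero _ _ _)
    rwa [one_mul] at this
  conv_rhs => rw [← MvPolynomial.sum_homogeneousComponent a, map_sum, map_sum]
  simp only [MvPolynomial.homogeneousComponent_of_mem (h1 _)]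
  rw [Finset.sum_ite_eq]
  split_ifs with h
  · rfl
  · rw [MvPolynomial.homogeneousComponent_eq_zero, map_zero]
    simpa using h

/-- The point `(1 : 0 : … : 0)` of the special fibre. -/
noncomputable def coordinatePoint (n q : ℕ) : ProjectiveSpectrum (gradingS n (q + 1)) where
  asHomogeneousIdeal :=
    { toSubmodule := RingHom.ker (reduceToLine n q)
      is_homogeneous' := by
        intro d a ha
        change reduceToLine n q (MvPolynomial.decomposition.decompose' a d : _) = 0
        rw [MvPolynomial.decomposition.decompose'_apply, reduceToLine_homogeneousComponent]
        rw [(ha : reduceToLine n q a = 0), map_zero] }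
  isPrime := RingHom.ker_isPrime (reduceToLine n q)
  not_irrelevant_le := by
    intro h
    have h1 : (MvPolynomial.X 0 : MvPolynomial (Fin (q + 1)) (OO n)) ∈
        HomogeneousIdeal.irrelevant (gradingS n (q + 1)) := by
      rw [HomogeneousIdeal.mem_irrelevant_iff, GradedRing.proj_apply]
      exact DirectSum.decompose_of_mem_ne _ (MvPolynomial.isHomogeneous_X (OO n) 0) one_ne_zero
    have h2 : reduceToLine n q (MvPolynomial.X 0) = 0 := h h1
    simp [reduceToLine] at h2

theorem coordinatePoint_mem_specialFibre (n q : ℕ) :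
    coordinatePoint n q ∈ specialFibre n (q + 1) := by
  refine (mem_specialFibre_iff (coordinatePoint n q)).mpr fun a => ?_
  change reduceToLine n q (MvPolynomial.C a) = 0 ↔ evalZero n a = 0
  simp [reduceToLine]

theorem sigma_mul {n q : ℕ} (m : OO n) (h : Fin q → OO n) :
    sigma (fun i => m * h i) = MvPolynomial.C m * sigma h := by
  simp [sigma, Finset.mul_sum, mul_assoc]

/-- At the point `(1 : 0 : … : 0)` a linear form is its first coefficient, up to a unit and the
maximal ideal. -/
theorem algebraMap_C_mem_sup {n q : ℕ} {I : Ideal (OO n)}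
    {T : Ideal (MvPolynomial (Fin (q + 1)) (OO n))} {h : Fin (q + 1) → OO n} (hT : sigma h ∈ T)
    (hI : ∀ i, h i ∈ I) :
    algebraMap (MvPolynomial (Fin (q + 1)) (OO n))
      (Localization.AtPrime (coordinatePoint n q).asHomogeneousIdeal.toIdeal)
        (MvPolynomial.C (h 0)) ∈
    T.map (algebraMap (MvPolynomial (Fin (q + 1)) (OO n))
      (Localization.AtPrime (coordinatePoint n q).asHomogeneousIdeal.toIdeal)) ⊔
      IsLocalRing.maximalIdeal
        (Localization.AtPrime (coordinatePoint n q).asHomogeneousIdeal.toIdeal) •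
      (I.map MvPolynomial.C).map
        (algebraMap (MvPolynomial (Fin (q + 1)) (OO n))
      (Localization.AtPrime (coordinatePoint n q).asHomogeneousIdeal.toIdeal)) := by
  set P := (coordinatePoint n q).asHomogeneousIdeal.toIdeal with hP
  let ι := algebraMap (MvPolynomial (Fin (q + 1)) (OO n)) (Localization.AtPrime P)
  have hu : IsUnit (ι (MvPolynomial.X 0)) := by
    rw [IsLocalization.AtPrime.isUnit_to_map_iff (Localization.AtPrime P) P]
    intro h0
    have h2 : reduceToLine n q (MvPolynomial.X 0) = 0 := h0
    simp [reduceToLine] at h2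
  rw [← Ideal.mul_unit_mem_iff_mem _ hu]
  change ι _ * ι _ ∈ _
  rw [← map_mul]
  have h1 : MvPolynomial.C (h 0) * MvPolynomial.X 0 =
      sigma h - ∑ i : Fin q, MvPolynomial.X i.succ * MvPolynomial.C (h i.succ) := by
    rw [sigma, Fin.sum_univ_succ]
    simp only [mul_comm (MvPolynomial.X _)]
    ring
  rw [h1, map_sub, map_sum]
  refine Ideal.sub_mem _ (Ideal.mem_sup_left (Ideal.mem_map_of_mem _ hT))
    (Ideal.mem_sup_right (Ideal.sum_mem _ fun i _ => ?_))
  rw [map_mul]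
  refine Ideal.mul_mem_mul ?_ (Ideal.mem_map_of_mem _ (Ideal.mem_map_of_mem _ (hI _)))
  rw [IsLocalization.AtPrime.to_map_mem_maximal_iff (Localization.AtPrime P) P]
  change reduceToLine n q (MvPolynomial.X i.succ) = 0
  simp [reduceToLine]

/-- Nakayama in the local ring `S_P`, with `algebraMap_C_mem_sup` applied to `σ` and to each `m
∂σ/∂xⱼ`; the degree-zero statement follows by contraction. -/
theorem map_TKIdeal_le_map_TKSigma {n q : ℕ} (g : Fin (q + 1) → OO n)
    (hg : TKIdeal (Ideal.span (Set.range g)) = TK (g 0)) :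
    ((TKIdeal (Ideal.span (Set.range g))).map MvPolynomial.C).map (algebraMap (MvPolynomial (Fin (q + 1)) (OO n))
      (Localization.AtPrime (coordinatePoint n q).asHomogeneousIdeal.toIdeal)) ≤
    (TKSigma g).map (algebraMap (MvPolynomial (Fin (q + 1)) (OO n))
      (Localization.AtPrime (coordinatePoint n q).asHomogeneousIdeal.toIdeal)) := by
  have hle : ∀ i, TK (g i) ≤ TK (g 0) := fun i => hg ▸ le_TKIdeal (Ideal.subset_span ⟨i, rfl⟩)
  rw [hg]
  refine Submodule.le_of_le_smul_of_le_jacobson_bot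
    (Ideal.FG.map (Ideal.FG.map (IsNoetherian.noetherian (TK (g 0))) _) _)
    (IsLocalRing.maximalIdeal_le_jacobson _) ?_
  rw [Ideal.map_le_iff_le_comap, Ideal.map_le_iff_le_comap, TK_le_iff]
  constructor
  · exact algebraMap_C_mem_sup (Ideal.mem_sup_left (Ideal.mem_span_singleton_self _))
      fun i => hle i (self_mem_TK _)
  · intro m hm j
    refine algebraMap_C_mem_sup (h := fun i => m * partialDeriv j (g i)) ?_
      fun i => hle i (mul_partialDeriv_mem_TK hm j)
    rw [sigma_mul]
    exact Ideal.mem_sup_right (Ideal.mul_mem_mul (Ideal.mem_map_of_mem _ hm)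
      (Ideal.subset_span ⟨j, rfl⟩))

theorem isTKDependent_antiDeriv_TK {n : ℕ} (f : OO n) : IsTKDependent (antiDeriv (TK f)) := by
  obtain ⟨q, g, hg⟩ := Submodule.fg_iff_exists_fin_generating_family.mp
    (IsNoetherian.noetherian (antiDeriv (TK f)))
  -- Any generating system may be used, so `f` is put in front, at the coordinate that is a unit at
  -- `(1 : 0 : … : 0)`.
  have hspan : Ideal.span (Set.range (Fin.cons f g : Fin (q + 1) → OO n)) = antiDeriv (TK f) := by
    rw [Fin.range_cons, Ideal.span_insert]
    refine (congrArg _ hg).trans (sup_eq_right.mpr ?_)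
    rw [Ideal.span_singleton_le_iff_mem]
    exact le_refl (TK f)
  refine ⟨q + 1, Fin.cons f g, q.succ_pos, hspan, fun h => ?_⟩
  refine (notMem_sheafSupport_iff _ (coordinatePoint n q)).mpr ?_
    (h (coordinatePoint_mem_specialFibre n q))
  refine Ideal.comap_mono (map_TKIdeal_le_map_TKSigma _ ?_)
  rw [hspan, TKIdeal_antiDeriv_TK, Fin.cons_zero]

end Dependence

theorem theorem1 (n : ℕ) (I : Ideal (OO n)) (hI : I ≠ ⊤) :
    IsModuliIdeal I ↔ IsTKFull I ∧ IsTKDependent (antiDeriv I) := by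
  constructor
  · rintro ⟨f, -, rfl⟩
    exact ⟨TKIdeal_antiDeriv_TK f, isTKDependent_antiDeriv_TK f⟩
  · rintro ⟨hfull, hdep⟩
    exact isModuliIdeal_of_isTKDependent hI hfull hdep
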